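/- Let $\mathcal A$ be a central hyperplane arrangement in $\mathbb R^n$, i.e. a finite nonempty set of codimension-one linear subspaces. Its rank is the dimension of the linear span of the normal vectors of its hyperplanes. Its regions are the closures of the connected components of $\mathbb R^n\setminus\bigcup_{H\in\mathcal A}H$. For a region $B$, the poset of regions $\mathcal P(\mathcal A,B)$ is the set of regions with $R_1\le R_2$ if and only if $S(R_1)\subseteq S(R_2)$, where $S(R)$ is the set of hyperplanes in $\mathcal A$ separating $R$ from $B$. The arrangement $\mathcal A$ is supersolvable if its lattice of intersections $L(\mathcal A)$, ordered by reverse inclusion, has a maximal chain all of whose elements $x$ are modular, i.e. satisfy $z\vee(x\wedge y)=(z\vee x)\wedge y$ for all $y,z\in L(\mathcal A)$ with $z\le y$. Canonical base regions are defined inductively. Every region of an arrangement of rank $1$ or $2$ is a canonical base region. If $\mathcal A=\mathcal A_0\uplus\mathcal A_1$, where $\mathcal A_0$ is a supersolvable arrangement with $\operatorname{rank}\mathcal A_0=\operatorname{rank}\mathcal A-1$ and for any distinct $H',H''\in\mathcal A_1$ there is a unique $H\in\mathcal A_0$ with $H'\cap H''\subseteq H$, then a region $B$ of $\mathcal A$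 is a canonical base region if the region $B_0$ of $\mathcal A_0$ containing $B$ is a canonical base region of $\mathcal A_0$ and the regions of $\mathcal A$ contained in $B_0$ are linearly ordered in $\mathcal P(\mathcal A,B)$. The order dimension of a finite poset $P$ is the smallest $d$ such that the order of $P$ is the intersection (as relations) of $d$ linear extensions of $P$. Theorem. Let $\mathcal A$ be a supersolvable central hyperplane arrangement and let $B$ be a canonical base region of $\mathcal A$. Then the order dimension of $\mathcal P(\mathcal A,B)$ is equal to the rank of $\mathcal A$. -/

import Mathlib

/-- `L` is the intersection, as relations, of `d` linear orders on the same ground set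
(each of them is then automatically a linear extension). -/
def IsIntersectionOfLinearExtensions (P : Type*) [PartialOrder P] (d : ℕ) : Prop :=
  ∃ L : Fin d → LinearOrder P, ∀ x y : P, x ≤ y ↔ ∀ i, (L i).le x y

/-- `d` is the order dimension of the poset `P`: the smallest number of linear extensions of `P`
whose intersection is the order of `P`. -/
def IsOrderDimension (P : Type*) [PartialOrder P] (d : ℕ) : Prop :=
  IsLeast {k : ℕ | IsIntersectionOfLinearExtensions P k} d

/-- `x` is a modular element of the lattice `L`: every `(x, y)` is a modular pair. -/
def IsModularElement {L : Type*} [Lattice L] (x : L) : Prop :=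
  ∀ y z : L, z ≤ y → z ⊔ (x ⊓ y) = (z ⊔ x) ⊓ y

/-- A (finite geometric) lattice is supersolvable if it has a maximal chain consisting of
modular elements. -/
def IsSupersolvableLattice (L : Type*) [Lattice L] : Prop :=
  ∃ C : Set L, IsMaxChain (· ≤ ·) C ∧ ∀ x ∈ C, IsModularElement x

/-- A central hyperplane arrangement in `ℝⁿ`: a finite nonempty set of linear subspaces of
codimension one. -/
structure Arrangement (n : ℕ) where
  carrier : Set (Submodule ℝ (EuclideanSpace ℝ (Fin n)))
  finite : carrier.Finite
  nonempty : carrier.Nonempty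
  codim_one : ∀ H ∈ carrier, Module.finrank ℝ H + 1 = n

namespace Arrangement

variable {n : ℕ}

/-- The span of the arrangement: the linear span of the normal vectors of its hyperplanes. -/
def normalSpan (A : Arrangement n) : Submodule ℝ (EuclideanSpace ℝ (Fin n)) :=
  Submodule.span ℝ {v | ∃ H ∈ A.carrier, v ∈ Hᗮ}

/-- The rank of the arrangement: the dimension of its span. -/
noncomputable def rank (A : Arrangement n) : ℕ := Module.finrank ℝ A.normalSpan

/-! ### The intersection lattice -/

/-- The intersections of hyperplanes of `A` (the empty intersection being the whole space). -/
structure Flat (A : Arrangement n) where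
  space : Submodule ℝ (EuclideanSpace ℝ (Fin n))
  isInter : ∃ T ⊆ A.carrier, space = sInf T

theorem Flat.ext' {A : Arrangement n} {X Y : Flat A} (h : X.space = Y.space) : X = Y := by
  cases X; cases Y; cases h; rfl

/-- The order on the intersection lattice is reverse inclusion; the join of two flats is their
intersection, and their meet is the intersection of all hyperplanes that contain both. -/
instance (A : Arrangement n) : Lattice (Flat A) where
  le X Y := Y.space ≤ X.space
  le_refl _ := le_rfl
  le_trans _ _ _ h₁ h₂ := le_trans (α := Submodule ℝ (EuclideanSpace ℝ (Fin n))) h₂ h₁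
  le_antisymm _ _ h₁ h₂ := Flat.ext' (le_antisymm h₂ h₁)
  sup X Y :=
    { space := X.space ⊓ Y.space
      isInter := by
        obtain ⟨S, hS, hX⟩ := X.isInter
        obtain ⟨T, hT, hY⟩ := Y.isInter
        exact ⟨S ∪ T, Set.union_subset hS hT, by rw [hX, hY, sInf_union]⟩ }
  le_sup_left _ _ := inf_le_left (α := Submodule ℝ (EuclideanSpace ℝ (Fin n)))
  le_sup_right _ _ := inf_le_right (α := Submodule ℝ (EuclideanSpace ℝ (Fin n)))
  sup_le _ _ _ h₁ h₂ := le_inf (α := Submodule ℝ (EuclideanSpace ℝ (Fin n))) h₁ h₂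
  inf X Y :=
    { space := sInf {H | H ∈ A.carrier ∧ X.space ≤ H ∧ Y.space ≤ H}
      isInter := ⟨_, fun _ h => h.1, rfl⟩ }
  inf_le_left _ _ := le_sInf fun _ h => h.2.1
  inf_le_right _ _ := le_sInf fun _ h => h.2.2
  le_inf X Y Z h₁ h₂ := by
    obtain ⟨T, hT, hX⟩ := X.isInter
    have h₁' : Y.space ≤ X.space := h₁
    have h₂' : Z.space ≤ X.space := h₂
    change sInf {H | H ∈ A.carrier ∧ Y.space ≤ H ∧ Z.space ≤ H} ≤ X.space
    rw [hX] at h₁' h₂' ⊢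
    exact le_sInf fun H hH =>
      sInf_le ⟨hT hH, h₁'.trans (sInf_le hH), h₂'.trans (sInf_le hH)⟩

/-- An arrangement is supersolvable if its lattice of intersections is. -/
def IsSupersolvable (A : Arrangement n) : Prop := IsSupersolvableLattice (Flat A)

/-! ### Regions -/

/-- The complement of the union of the hyperplanes. -/
def complement (A : Arrangement n) : Set (EuclideanSpace ℝ (Fin n)) :=
  {x | ∀ H ∈ A.carrier, x ∉ H}

/-- The regions of `A`: the closures of the connected components of the complement. -/
structure Region (A : Arrangement n) where
  set : Set (EuclideanSpace ℝ (Fin n))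
  isRegion : ∃ x ∈ A.complement, set = closure (connectedComponentIn A.complement x)

/-- The hyperplane `H` separates `R₁` from `R₂`: they lie on opposite sides of `H`. -/
def Separates (H : Submodule ℝ (EuclideanSpace ℝ (Fin n)))
    (R₁ R₂ : Set (EuclideanSpace ℝ (Fin n))) : Prop :=
  ∃ v ∈ Hᗮ, v ≠ 0 ∧ (∀ x ∈ R₁, 0 ≤ inner ℝ v x) ∧ (∀ x ∈ R₂, inner ℝ v x ≤ 0)

/-- The set `S(R₁, R₂)` of hyperplanes of `A` that separate `R₁` from `R₂`. -/
def separatingSet (A : Arrangement n) (R₁ R₂ : Region A) :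
    Set (Submodule ℝ (EuclideanSpace ℝ (Fin n))) :=
  {H | H ∈ A.carrier ∧ Separates H R₁.set R₂.set}

/-! Facts which show that a region is determined by its separating set. -/

theorem inner_eq_zero_iff_mem (A : Arrangement n) {H : Submodule ℝ (EuclideanSpace ℝ (Fin n))}
    (hH : H ∈ A.carrier) {v : EuclideanSpace ℝ (Fin n)} (hv : v ∈ Hᗮ) (hv0 : v ≠ 0)
    (x : EuclideanSpace ℝ (Fin n)) : inner ℝ v x = 0 ↔ x ∈ H := by
  have hle : H ≤ (Submodule.span ℝ {v})ᗮ := by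
    intro y hy
    rw [Submodule.mem_orthogonal_singleton_iff_inner_right]
    exact Submodule.inner_left_of_mem_orthogonal hy hv
  have h1 := A.codim_one H hH
  have h2 := Submodule.finrank_add_finrank_orthogonal (Submodule.span ℝ {v})
  rw [finrank_span_singleton hv0, finrank_euclideanSpace_fin] at h2
  have heq := Submodule.eq_of_le_of_finrank_eq hle (by omega)
  rw [← Submodule.mem_orthogonal_singleton_iff_inner_right, ← heq]

theorem exists_normal (A : Arrangement n) {H : Submodule ℝ (EuclideanSpace ℝ (Fin n))}
    (hH : H ∈ A.carrier) : ∃ v ∈ Hᗮ, v ≠ 0 := by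
  apply Submodule.exists_mem_ne_zero_of_ne_bot
  intro h
  have h1 := A.codim_one H hH
  have h2 := Submodule.finrank_add_finrank_orthogonal H
  rw [h, finrank_bot, finrank_euclideanSpace_fin] at h2
  omega

theorem inner_nonneg_of_mem_region (A : Arrangement n)
    {H : Submodule ℝ (EuclideanSpace ℝ (Fin n))}
    (hH : H ∈ A.carrier) {v : EuclideanSpace ℝ (Fin n)} (hv : v ∈ Hᗮ) (hv0 : v ≠ 0)
    {x : EuclideanSpace ℝ (Fin n)} (hx : x ∈ A.complement) (hpos : 0 < inner ℝ v x) :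
    ∀ y ∈ closure (connectedComponentIn A.complement x), 0 ≤ inner ℝ v y := by
  have hcont : Continuous fun y : EuclideanSpace ℝ (Fin n) => inner ℝ v y := by fun_prop
  have hsub : connectedComponentIn A.complement x ⊆ {y | 0 ≤ inner ℝ v y} := by
    intro y hy
    by_contra hneg
    simp only [Set.mem_ofPred_eq, not_le] at hneg
    obtain ⟨z, hz, hz0⟩ := isPreconnected_connectedComponentIn.intermediate_value hy
      (mem_connectedComponentIn hx) hcont.continuousOn ⟨hneg.le, hpos.le⟩
    exact connectedComponentIn_subset _ _ hz H hH
      ((A.inner_eq_zero_iff_mem hH hv hv0 z).1 hz0)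
  exact closure_minimal hsub (isClosed_le continuous_const hcont)

theorem separates_iff_of_inner_neg (A : Arrangement n)
    {H : Submodule ℝ (EuclideanSpace ℝ (Fin n))}
    (hH : H ∈ A.carrier) {v : EuclideanSpace ℝ (Fin n)} (hv : v ∈ Hᗮ) (hv0 : v ≠ 0)
    {x b : EuclideanSpace ℝ (Fin n)} (hx : x ∈ A.complement) (hb : b ∈ A.complement)
    (hneg : inner ℝ v b < 0) :
    Separates H (closure (connectedComponentIn A.complement x))
      (closure (connectedComponentIn A.complement b)) ↔ 0 < inner ℝ v x := by
  constructor
  · rintro ⟨w, hw, hw0, h1, h2⟩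
    have h1 := h1 x (subset_closure (mem_connectedComponentIn hx))
    have h2 := h2 b (subset_closure (mem_connectedComponentIn hb))
    have key : inner ℝ v ((inner ℝ w x) • b - (inner ℝ w b) • x) = 0 := by
      rw [A.inner_eq_zero_iff_mem hH hv hv0, ← A.inner_eq_zero_iff_mem hH hw hw0,
        inner_sub_right, inner_smul_right, inner_smul_right]
      ring
    rw [inner_sub_right, inner_smul_right, inner_smul_right] at key
    have h1' : inner ℝ w x ≠ 0 := fun h => hx H hH ((A.inner_eq_zero_iff_mem hH hw hw0 x).1 h)
    have h1'' : 0 < inner ℝ w x := lt_of_le_of_ne h1 h1'.symm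
    by_contra hle
    rw [not_lt] at hle
    nlinarith [mul_nonneg_of_nonpos_of_nonpos h2 hle, mul_neg_of_pos_of_neg h1'' hneg]
  · intro hpos
    refine ⟨v, hv, hv0, A.inner_nonneg_of_mem_region hH hv hv0 hx hpos, fun y hy => ?_⟩
    have := A.inner_nonneg_of_mem_region hH (neg_mem hv) (neg_ne_zero.2 hv0) hb
      (by rw [inner_neg_left]; linarith) y hy
    rw [inner_neg_left] at this
    linarith

theorem region_eq_of_separatingSet_eq (A : Arrangement n) {B R R' : Region A}
    (h : A.separatingSet R B = A.separatingSet R' B) : R = R' := by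
  obtain ⟨B, b, hb, rfl⟩ := B
  obtain ⟨R, x, hx, rfl⟩ := R
  obtain ⟨R', y, hy, rfl⟩ := R'
  have hseg : segment ℝ x y ⊆ A.complement := by
    rintro z ⟨s, t, hs, ht, hst, rfl⟩ H hH hz
    obtain ⟨v, hv, hv0, hneg⟩ : ∃ v ∈ Hᗮ, v ≠ 0 ∧ inner ℝ v b < 0 := by
      obtain ⟨v, hv, hv0⟩ := A.exists_normal hH
      rcases lt_trichotomy (inner ℝ v b) 0 with h1 | h1 | h1
      · exact ⟨v, hv, hv0, h1⟩
      · exact absurd ((A.inner_eq_zero_iff_mem hH hv hv0 b).1 h1) (hb H hH)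
      · exact ⟨-v, neg_mem hv, neg_ne_zero.2 hv0, by rw [inner_neg_left]; linarith⟩
    have hiff : 0 < inner ℝ v x ↔ 0 < inner ℝ v y := by
      rw [← A.separates_iff_of_inner_neg hH hv hv0 hx hb hneg,
        ← A.separates_iff_of_inner_neg hH hv hv0 hy hb hneg]
      have := Set.ext_iff.1 h H
      simpa only [separatingSet, Set.mem_ofPred_eq, hH, true_and] using this
    have hx0 : inner ℝ v x ≠ 0 := fun h => hx H hH ((A.inner_eq_zero_iff_mem hH hv hv0 x).1 h)
    have hy0 : inner ℝ v y ≠ 0 := fun h => hy H hH ((A.inner_eq_zero_iff_mem hH hv hv0 y).1 h)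
    have hz0 := (A.inner_eq_zero_iff_mem hH hv hv0 _).2 hz
    rw [inner_add_right, inner_smul_right, inner_smul_right] at hz0
    rcases hs.eq_or_lt with rfl | hs
    · have : t = 1 := by linarith
      subst this
      apply hy0; linarith
    · rcases lt_or_gt_of_ne hx0 with hx1 | hx1
      · have hy1 : inner ℝ v y ≤ 0 := not_lt.1 fun h => by linarith [hiff.2 h]
        nlinarith [mul_neg_of_pos_of_neg hs hx1, mul_nonpos_of_nonneg_of_nonpos ht hy1]
      · have hy1 := hiff.1 hx1
        nlinarith [mul_pos hs hx1, mul_nonneg ht hy1.le]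
  have hmem : y ∈ connectedComponentIn A.complement x :=
    (convex_segment x y).isPreconnected.subset_connectedComponentIn
      (left_mem_segment ℝ x y) hseg (right_mem_segment ℝ x y)
  have := connectedComponentIn_eq hmem
  simp only [this]

/-- The poset of regions `P(A, B)` of `A` with respect to the base region `B`: its elements are the
regions of `A`. -/
structure PosetOfRegions (A : Arrangement n) (B : Region A) where
  region : Region A

/-- Regions are ordered by containment of their separating sets `S(R) = S(R, B)`. -/
instance (A : Arrangement n) (B : Region A) : PartialOrder (PosetOfRegions A B) where
  le R₁ R₂ := A.separatingSet R₁.region B ⊆ A.separatingSet R₂.region B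
  le_refl _ := Set.Subset.rfl
  le_trans _ _ _ h₁ h₂ := Set.Subset.trans h₁ h₂
  le_antisymm R₁ R₂ h₁ h₂ := by
    cases R₁; cases R₂
    exact congrArg _ (A.region_eq_of_separatingSet_eq (Set.Subset.antisymm h₁ h₂))

/-! ### Canonical base regions -/

/-- `A = A₀ ⊎ A₁` (with `A₁` the set of hyperplanes of `A` that are not in `A₀`), where `A₀` is a
supersolvable arrangement of rank one less than that of `A`, and for any two distinct hyperplanes
`H', H''` in `A₁` there is a unique `H` in `A₀` that contains `H' ∩ H''`. -/
structure IsSupersolvableDecomposition (A A₀ : Arrangement n) : Prop where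
  subset : A₀.carrier ⊆ A.carrier
  supersolvable : A₀.IsSupersolvable
  rank_eq : A₀.rank + 1 = A.rank
  existsUnique : ∀ H' ∈ A.carrier \ A₀.carrier, ∀ H'' ∈ A.carrier \ A₀.carrier, H' ≠ H'' →
    ∃! H, H ∈ A₀.carrier ∧ H' ⊓ H'' ≤ H

/-- Canonical base regions. Every region of an arrangement of rank one or two is canonical.
If `A = A₀ ⊎ A₁` is a decomposition as above, then a region `B` of `A` is canonical if the region
`B₀` of `A₀` that contains `B` is canonical, and the regions of `A` contained in `B₀` are linearly
ordered in `P(A, B)`. -/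
inductive IsCanonicalBase : (A : Arrangement n) → Region A → Prop
  | of_rank_le_two (A : Arrangement n) (B : Region A) (h : A.rank ≤ 2) : IsCanonicalBase A B
  | step (A A₀ : Arrangement n) (B : Region A) (B₀ : Region A₀)
      (hA : IsSupersolvableDecomposition A A₀) (hB : B.set ⊆ B₀.set)
      (hB₀ : IsCanonicalBase A₀ B₀)
      (hlin : IsChain (· ≤ ·) {R : PosetOfRegions A B | R.region.set ⊆ B₀.set}) :
      IsCanonicalBase A B

end Arrangement

/-!
The dimension is computed from points in place of regions. Fix a point `b` of the base region. A
region is recorded by the set of hyperplanes that separate one of its points from `b`, and the poset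
of regions is the containment order on these sets.

*Upper bound.* Let `A = A₀ ⊎ A₁` be a decomposition as in the definition of canonical base regions.
Comparing ranks gives a vector `v` that lies in all hyperplanes of `A₀` and in none of `A₁`. Since
the regions of `A` inside the region of `A₀` around `b` form a chain, `v` can be oriented so that
the half-line from `b` in direction `v` crosses every hyperplane of `A₁`
(`IsSupersolvableDecomposition.exists_crossing_direction`). Order `A₁` by the moment of crossing,
and compare subsets of `A₁` lexicographically, an earlier hyperplane counting more. This is one
total preorder on regions, and together with preorders that realize the poset of `A₀` it realizes
the poset of `A` (`HasRankings.union`). Indeed, suppose that `S₀(x) ⊆ S₀(y)`, that `H'` separates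
`x` but not `y` from `b`, and `H''` separates `y` but not `x`, both in `A₁`. Let `a'`, `a''` be their
normal vectors with value `1` at `v`. Then `a' - a''` vanishes on `H' ∩ H''` and at `v`, so it is a
normal vector of the hyperplane of `A₀` that contains `H' ∩ H''`; it is positive at `x` and negative
at `y`. If it were negative at `b`, that hyperplane would lie in `S₀(x)` and not in `S₀(y)`. So it is
positive at `b`, which says that `H'` is crossed before `H''`, and `S₁(x)` is lexicographically the
larger set. Hence each step of the induction adds at most one to the dimension, as it adds one to
the rank. Ranks one and two are the
same construction with `A₀` empty and `A₀` a single facet of the base region.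

*Lower bound.* The facets of the base region span the arrangement (`exists_facets`). The regions
beyond them, together with their antipodes, form the standard example of a poset whose dimension is
the number of facets, which is at least the rank (`rank_le_of_isIntersectionOfLinearExtensions`).
-/

namespace Arrangement

open Filter Topology

variable {n : ℕ}

/-! ### Separation of points by hyperplanes -/

/-- The points `x` and `b` lie strictly on opposite sides of `H`: some normal vector of `H` is
positive at `x` and negative at `b`. -/
def SeparatesPoints (H : Submodule ℝ (EuclideanSpace ℝ (Fin n)))
    (x b : EuclideanSpace ℝ (Fin n)) : Prop :=
  ∃ w ∈ Hᗮ, 0 < inner ℝ w x ∧ inner ℝ w b < 0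

theorem exists_normal_inner_neg (A : Arrangement n)
    {H : Submodule ℝ (EuclideanSpace ℝ (Fin n))} (hH : H ∈ A.carrier)
    {b : EuclideanSpace ℝ (Fin n)} (hb : b ∉ H) : ∃ w ∈ Hᗮ, inner ℝ w b < 0 := by
  obtain ⟨v, hv, hv0⟩ := A.exists_normal hH
  rcases lt_trichotomy (inner ℝ v b) 0 with h1 | h1 | h1
  · exact ⟨v, hv, h1⟩
  · exact absurd ((A.inner_eq_zero_iff_mem hH hv hv0 b).1 h1) hb
  · exact ⟨-v, neg_mem hv, by rw [inner_neg_left]; linarith⟩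

theorem ne_zero_of_inner_neg {w b : EuclideanSpace ℝ (Fin n)} (h : inner ℝ w b < 0) : w ≠ 0 := by
  rintro rfl
  simp at h

/-- Whether `H` separates `x` from `b` can be read off from any one normal vector that is negative
at `b`. -/
theorem separatesPoints_iff (A : Arrangement n)
    {H : Submodule ℝ (EuclideanSpace ℝ (Fin n))} (hH : H ∈ A.carrier)
    {w x b : EuclideanSpace ℝ (Fin n)} (hw : w ∈ Hᗮ) (hwb : inner ℝ w b < 0) :
    SeparatesPoints H x b ↔ 0 < inner ℝ w x := by
  refine ⟨?_, fun h => ⟨w, hw, h, hwb⟩⟩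
  rintro ⟨w', hw', hx, hb⟩
  have key : inner ℝ w ((inner ℝ w' x) • b - (inner ℝ w' b) • x) = 0 := by
    rw [A.inner_eq_zero_iff_mem hH hw (ne_zero_of_inner_neg hwb),
      ← A.inner_eq_zero_iff_mem hH hw' (ne_zero_of_inner_neg hb),
      inner_sub_right, inner_smul_right, inner_smul_right]
    ring
  rw [inner_sub_right, inner_smul_right, inner_smul_right] at key
  by_contra hle
  rw [not_lt] at hle
  nlinarith [mul_nonneg_of_nonpos_of_nonpos hb.le hle, mul_neg_of_pos_of_neg hx hwb]

/-- A normal vector is determined by its value at a point off the hyperplane. -/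
theorem eq_of_mem_orthogonal_of_inner_eq (A : Arrangement n)
    {H : Submodule ℝ (EuclideanSpace ℝ (Fin n))} (hH : H ∈ A.carrier)
    {p q v : EuclideanSpace ℝ (Fin n)} (hp : p ∈ Hᗮ) (hq : q ∈ Hᗮ) (hv : v ∉ H)
    (h : (inner ℝ p v : ℝ) = inner ℝ q v) : p = q := by
  by_contra hne
  exact hv ((A.inner_eq_zero_iff_mem hH (sub_mem hp hq) (sub_ne_zero.2 hne) v).1
    (by rw [inner_sub_left, h, sub_self]))

theorem eq_of_mem_orthogonal (A : Arrangement n)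
    {H H' : Submodule ℝ (EuclideanSpace ℝ (Fin n))} (hH : H ∈ A.carrier) (hH' : H' ∈ A.carrier)
    {w : EuclideanSpace ℝ (Fin n)} (hw : w ∈ Hᗮ) (hw' : w ∈ H'ᗮ) (hw0 : w ≠ 0) : H = H' := by
  ext z
  rw [← A.inner_eq_zero_iff_mem hH hw hw0, A.inner_eq_zero_iff_mem hH' hw' hw0]

theorem exists_add_eq_of_inf_le {H H' H'' : Submodule ℝ (EuclideanSpace ℝ (Fin n))}
    (h : H' ⊓ H'' ≤ H) {w : EuclideanSpace ℝ (Fin n)} (hw : w ∈ Hᗮ) :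
    ∃ p ∈ H'ᗮ, ∃ q ∈ H''ᗮ, p + q = w := by
  have h1 : Hᗮ ≤ H'ᗮ ⊔ H''ᗮ := by
    rw [← Submodule.orthogonal_orthogonal (H'ᗮ ⊔ H''ᗮ), ← Submodule.inf_orthogonal,
      Submodule.orthogonal_orthogonal, Submodule.orthogonal_orthogonal]
    exact Submodule.orthogonal_le h
  exact Submodule.mem_sup.1 (h1 hw)

/-- If `H` contains `H' ∩ H''` and the vector `v`, then the difference of the normal vectors of
`H'` and `H''` that take the value `1` at `v` is a normal vector of `H`. -/
theorem sub_mem_orthogonal_of_inf_le (A : Arrangement n)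
    {H H' H'' : Submodule ℝ (EuclideanSpace ℝ (Fin n))} (hH : H ∈ A.carrier)
    (hH' : H' ∈ A.carrier) (hH'' : H'' ∈ A.carrier) (h : H' ⊓ H'' ≤ H)
    {v a c : EuclideanSpace ℝ (Fin n)} (hv : v ∈ H) (ha : a ∈ H'ᗮ) (hc : c ∈ H''ᗮ)
    (hav : (inner ℝ a v : ℝ) = 1) (hcv : (inner ℝ c v : ℝ) = 1) :
    a - c ∈ Hᗮ ∧ a - c ≠ 0 := by
  obtain ⟨w, hw, hw0⟩ := A.exists_normal hH
  obtain ⟨p, hp, q, hq, hpq⟩ := exists_add_eq_of_inf_le h hw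
  have hv' : v ∉ H' := fun hm => by
    have := Submodule.inner_left_of_mem_orthogonal hm ha
    rw [hav] at this; exact one_ne_zero this
  have hv'' : v ∉ H'' := fun hm => by
    have := Submodule.inner_left_of_mem_orthogonal hm hc
    rw [hcv] at this; exact one_ne_zero this
  have hp' : p = (inner ℝ p v : ℝ) • a :=
    A.eq_of_mem_orthogonal_of_inner_eq hH' hp (Submodule.smul_mem _ _ ha) hv'
      (by rw [real_inner_smul_left, hav, mul_one])
  have hq' : q = (inner ℝ q v : ℝ) • c :=
    A.eq_of_mem_orthogonal_of_inner_eq hH'' hq (Submodule.smul_mem _ _ hc) hv''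
      (by rw [real_inner_smul_left, hcv, mul_one])
  have hwv : (inner ℝ w v : ℝ) = 0 := Submodule.inner_left_of_mem_orthogonal hv hw
  have hsum : (inner ℝ q v : ℝ) = - inner ℝ p v := by
    rw [← hpq, inner_add_left] at hwv; linarith
  have hweq : w = (inner ℝ p v : ℝ) • (a - c) := by
    rw [smul_sub, ← hp', ← hpq]
    rw [hsum, neg_smul] at hq'
    rw [sub_eq_add_neg, ← hq']
  have hp0 : (inner ℝ p v : ℝ) ≠ 0 := fun h0 => hw0 (by rw [hweq, h0, zero_smul])
  refine ⟨?_, fun h0 => hw0 (by rw [hweq, h0, smul_zero])⟩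
  have : a - c = (inner ℝ p v : ℝ)⁻¹ • w := by
    rw [hweq, smul_smul, inv_mul_cancel₀ hp0, one_smul]
  rw [this]
  exact Submodule.smul_mem _ _ hw

/-! ### Ranking functions -/

/-- On the points off the hyperplanes in `S`, containment of the sets of hyperplanes in `S` that
separate from `b` is the intersection of `d` total preorders. The preorders are given by functions
into one fixed linear order, that of finite sets of reals in the colexicographic order. -/
def HasRankings (S : Set (Submodule ℝ (EuclideanSpace ℝ (Fin n))))
    (b : EuclideanSpace ℝ (Fin n)) (d : ℕ) : Prop :=
  ∃ f : Fin d → EuclideanSpace ℝ (Fin n) → Colex (Finset ℝ),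
    ∀ x y, (∀ H ∈ S, x ∉ H) → (∀ H ∈ S, y ∉ H) →
      ((∀ H ∈ S, SeparatesPoints H x b → SeparatesPoints H y b) ↔ ∀ i, f i x ≤ f i y)

theorem hasRankings_empty (b : EuclideanSpace ℝ (Fin n)) : HasRankings ∅ b 0 :=
  ⟨fun i => i.elim0, fun _ _ _ _ => ⟨fun _ i => i.elim0, fun _ _ hH => hH.elim⟩⟩

/-- One further ranking suffices to pass from `S` to `S ∪ T`, if the hyperplanes in `T` are crossed
by a half-line from `b` whose direction `v` lies in all hyperplanes of `S`, and any two of them meet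
inside a hyperplane of `S`. The ranking compares the sets of separating hyperplanes in `T`
colexicographically, where hyperplanes met earlier on this half-line count more. -/
theorem HasRankings.union (A : Arrangement n)
    {S T : Set (Submodule ℝ (EuclideanSpace ℝ (Fin n)))} (hS : S ⊆ A.carrier) (hT : T ⊆ A.carrier)
    {b v : EuclideanSpace ℝ (Fin n)} (hb : ∀ H ∈ S, b ∉ H) (hv : ∀ H ∈ S, v ∈ H)
    (hsep : ∀ H ∈ T, SeparatesPoints H v b)
    (hinter : ∀ H' ∈ T, ∀ H'' ∈ T, H' ≠ H'' → ∃ H ∈ S, H' ⊓ H'' ≤ H)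
    {d : ℕ} (h : HasRankings S b d) : HasRankings (S ∪ T) b (d + 1) := by
  classical
  obtain ⟨f, hf⟩ := h
  have hTfin : T.Finite := A.finite.subset hT
  have hnormal : ∀ H, ∃ a : EuclideanSpace ℝ (Fin n),
      H ∈ T → a ∈ Hᗮ ∧ (inner ℝ a v : ℝ) = 1 ∧ inner ℝ a b < 0 := by
    intro H
    by_cases hH : H ∈ T
    · obtain ⟨w, hw, hwv, hwb⟩ := hsep H hH
      refine ⟨(inner ℝ w v : ℝ)⁻¹ • w, fun _ => ⟨Submodule.smul_mem _ _ hw, ?_, ?_⟩⟩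
      · rw [real_inner_smul_left, inv_mul_cancel₀ hwv.ne']
      · rw [real_inner_smul_left]
        exact mul_neg_of_pos_of_neg (inv_pos.2 hwv) hwb
    · exact ⟨0, fun h => absurd h hH⟩
  choose a ha using hnormal
  have hsepT : ∀ H ∈ T, ∀ x, SeparatesPoints H x b ↔ 0 < inner ℝ (a H) x := fun H hH x =>
    A.separatesPoints_iff (hT hH) (ha H hH).1 (ha H hH).2.2
  -- Distinct hyperplanes of `T` are met at distinct points of the line.
  have hinj : ∀ H' ∈ T, ∀ H'' ∈ T, (inner ℝ (a H') b : ℝ) = inner ℝ (a H'') b → H' = H'' := by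
    intro H' hH' H'' hH'' heq
    by_contra hne
    obtain ⟨H, hH, hle⟩ := hinter H' hH' H'' hH'' hne
    obtain ⟨h1, h2⟩ := A.sub_mem_orthogonal_of_inf_le (hS hH) (hT hH') (hT hH'') hle (hv H hH)
      (ha H' hH').1 (ha H'' hH'').1 (ha H' hH').2.1 (ha H'' hH'').2.1
    exact hb H hH ((A.inner_eq_zero_iff_mem (hS hH) h1 h2 b).1
      (by rw [inner_sub_left, heq, sub_self]))
  let g : EuclideanSpace ℝ (Fin n) → Finset ℝ := fun x =>
    (hTfin.toFinset.filter fun H => 0 < inner ℝ (a H) x).image fun H => inner ℝ (a H) b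
  have hg : ∀ H ∈ T, ∀ x, (inner ℝ (a H) b : ℝ) ∈ g x ↔ 0 < inner ℝ (a H) x := by
    intro H hH x
    simp only [g, Finset.mem_image, Finset.mem_filter, Set.Finite.mem_toFinset]
    constructor
    · rintro ⟨H', ⟨hH', hpos⟩, heq⟩
      rwa [hinj H' hH' H hH heq] at hpos
    · exact fun hpos => ⟨H, ⟨hH, hpos⟩, rfl⟩
  have hg' : ∀ x r, r ∈ g x → ∃ H ∈ T, r = inner ℝ (a H) b ∧ 0 < inner ℝ (a H) x := by
    intro x r hr
    simp only [g, Finset.mem_image, Finset.mem_filter, Set.Finite.mem_toFinset] at hr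
    obtain ⟨H, ⟨hH, hpos⟩, heq⟩ := hr
    exact ⟨H, hH, heq.symm, hpos⟩
  refine ⟨Fin.cons (fun x => toColex (g x)) f, fun x y hx hy => ?_⟩
  have hxS : ∀ H ∈ S, x ∉ H := fun H hH => hx H (Or.inl hH)
  have hyS : ∀ H ∈ S, y ∉ H := fun H hH => hy H (Or.inl hH)
  rw [Fin.forall_fin_succ]
  simp only [Fin.cons_zero, Fin.cons_succ]
  rw [← hf x y hxS hyS]
  constructor
  · intro hxy
    refine ⟨Finset.Colex.toColex_le_toColex_of_subset fun r hr => ?_,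
      fun H hH => hxy H (Or.inl hH)⟩
    obtain ⟨H, hH, rfl, hpos⟩ := hg' x r hr
    rw [hg H hH]
    exact (hsepT H hH y).1 (hxy H (Or.inr hH) ((hsepT H hH x).2 hpos))
  · rintro ⟨hle, hxy⟩ H' (hH' | hH') hsx
    · exact hxy H' hH' hsx
    by_contra hsy
    rw [hsepT H' hH'] at hsx hsy
    -- The ranking yields some `H''` in `T`, met no later than `H'`, that separates `y` but not `x`.
    obtain ⟨r, hry, hrx, hr⟩ := Finset.Colex.toColex_le_toColex.1 hle
      ((hg H' hH' x).2 hsx) (fun h => hsy ((hg H' hH' y).1 h))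
    obtain ⟨H'', hH'', rfl, hpos⟩ := hg' y r hry
    rw [hg H'' hH''] at hrx
    have hne : H' ≠ H'' := by rintro rfl; exact hsy hpos
    obtain ⟨H, hH, hle'⟩ := hinter H' hH' H'' hH'' hne
    obtain ⟨h1, h2⟩ := A.sub_mem_orthogonal_of_inf_le (hS hH) (hT hH') (hT hH'') hle' (hv H hH)
      (ha H' hH').1 (ha H'' hH'').1 (ha H' hH').2.1 (ha H'' hH'').2.1
    have hneg : inner ℝ (a H' - a H'') b < 0 := by
      refine lt_of_le_of_ne (by rw [inner_sub_left]; linarith) fun h0 => hb H hH ?_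
      exact (A.inner_eq_zero_iff_mem (hS hH) h1 h2 b).1 h0
    have := hxy H hH
    rw [A.separatesPoints_iff (hS hH) h1 hneg, A.separatesPoints_iff (hS hH) h1 hneg,
      inner_sub_left, inner_sub_left] at this
    rw [not_lt] at hrx hsy
    linarith [this (by linarith)]

/-! ### Regions and their points -/

theorem separatesPoints_neg_iff (A : Arrangement n)
    {H : Submodule ℝ (EuclideanSpace ℝ (Fin n))} (hH : H ∈ A.carrier)
    {x b : EuclideanSpace ℝ (Fin n)} (hx : x ∉ H) (hb : b ∉ H) :
    SeparatesPoints H (-x) b ↔ ¬ SeparatesPoints H x b := by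
  obtain ⟨w, hw, hwb⟩ := A.exists_normal_inner_neg hH hb
  rw [A.separatesPoints_iff hH hw hwb, A.separatesPoints_iff hH hw hwb, inner_neg_right]
  have h0 : (inner ℝ w x : ℝ) ≠ 0 := fun h =>
    hx ((A.inner_eq_zero_iff_mem hH hw (ne_zero_of_inner_neg hwb) x).1 h)
  constructor
  · intro h; linarith
  · intro h; have := lt_of_le_of_ne (not_lt.1 h) h0; linarith

/-- The region that contains a given point of the complement. -/
def regionOf (A : Arrangement n) (x : EuclideanSpace ℝ (Fin n)) (hx : x ∈ A.complement) :
    Region A :=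
  ⟨closure (connectedComponentIn A.complement x), x, hx, rfl⟩

theorem Region.exists_eq_regionOf {A : Arrangement n} (R : Region A) :
    ∃ x, ∃ hx : x ∈ A.complement, R = A.regionOf x hx := by
  obtain ⟨R, x, hx, rfl⟩ := R
  exact ⟨x, hx, rfl⟩

theorem mem_regionOf (A : Arrangement n) {x : EuclideanSpace ℝ (Fin n)} (hx : x ∈ A.complement) :
    x ∈ (A.regionOf x hx).set :=
  subset_closure (mem_connectedComponentIn hx)

theorem separates_regionOf_iff (A : Arrangement n)
    {H : Submodule ℝ (EuclideanSpace ℝ (Fin n))} (hH : H ∈ A.carrier)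
    {x b : EuclideanSpace ℝ (Fin n)} (hx : x ∈ A.complement) (hb : b ∈ A.complement) :
    Separates H (A.regionOf x hx).set (A.regionOf b hb).set ↔ SeparatesPoints H x b := by
  obtain ⟨w, hw, hwb⟩ := A.exists_normal_inner_neg hH (hb H hH)
  rw [A.separatesPoints_iff hH hw hwb]
  exact A.separates_iff_of_inner_neg hH hw (ne_zero_of_inner_neg hwb) hx hb hwb

theorem separatingSet_regionOf_subset_iff (A : Arrangement n) {x y b : EuclideanSpace ℝ (Fin n)}
    (hx : x ∈ A.complement) (hy : y ∈ A.complement) (hb : b ∈ A.complement) :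
    A.separatingSet (A.regionOf x hx) (A.regionOf b hb) ⊆
        A.separatingSet (A.regionOf y hy) (A.regionOf b hb) ↔
      ∀ H ∈ A.carrier, SeparatesPoints H x b → SeparatesPoints H y b := by
  constructor
  · intro h H hH hsx
    exact (A.separates_regionOf_iff hH hy hb).1
      (h ⟨hH, (A.separates_regionOf_iff hH hx hb).2 hsx⟩).2
  · rintro h H ⟨hH, hsx⟩
    exact ⟨hH, (A.separates_regionOf_iff hH hy hb).2
      (h H hH ((A.separates_regionOf_iff hH hx hb).1 hsx))⟩

theorem not_separatesPoints_self (A : Arrangement n)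
    {H : Submodule ℝ (EuclideanSpace ℝ (Fin n))} (hH : H ∈ A.carrier)
    {b : EuclideanSpace ℝ (Fin n)} (hb : b ∉ H) : ¬ SeparatesPoints H b b := by
  obtain ⟨w, hw, hwb⟩ := A.exists_normal_inner_neg hH hb
  rw [A.separatesPoints_iff hH hw hwb]
  exact not_lt.2 hwb.le

theorem regionOf_eq_of_not_separatesPoints (A : Arrangement n) {x b : EuclideanSpace ℝ (Fin n)}
    (hx : x ∈ A.complement) (hb : b ∈ A.complement)
    (h : ∀ H ∈ A.carrier, ¬ SeparatesPoints H x b) : A.regionOf x hx = A.regionOf b hb := by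
  refine A.region_eq_of_separatingSet_eq (B := A.regionOf b hb) (Set.Subset.antisymm ?_ ?_)
  · rw [separatingSet_regionOf_subset_iff]
    exact fun H hH hs => absurd hs (h H hH)
  · rw [separatingSet_regionOf_subset_iff]
    exact fun H hH hs => absurd hs (A.not_separatesPoints_self hH (hb H hH))

theorem regionOf_eq_of_mem (A : Arrangement n) {x b : EuclideanSpace ℝ (Fin n)}
    (hx : x ∈ A.complement) (hb : b ∈ A.complement) (h : x ∈ (A.regionOf b hb).set) :
    A.regionOf x hx = A.regionOf b hb := by
  refine A.regionOf_eq_of_not_separatesPoints hx hb fun H hH => ?_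
  obtain ⟨w, hw, hwb⟩ := A.exists_normal_inner_neg hH (hb H hH)
  rw [A.separatesPoints_iff hH hw hwb, not_lt]
  have := A.inner_nonneg_of_mem_region hH (neg_mem hw)
    (neg_ne_zero.2 (ne_zero_of_inner_neg hwb)) hb (by rw [inner_neg_left]; linarith) x h
  rw [inner_neg_left] at this
  linarith

/-- Rankings of the points of the complement give linear extensions of the poset of regions: ties
are broken by one linear extension of the whole poset. -/
theorem HasRankings.isIntersectionOfLinearExtensions (A : Arrangement n)
    {b : EuclideanSpace ℝ (Fin n)} (hb : b ∈ A.complement) {d : ℕ}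
    (h : HasRankings A.carrier b d) :
    IsIntersectionOfLinearExtensions (PosetOfRegions A (A.regionOf b hb)) d := by
  obtain ⟨f, hf⟩ := h
  have hpt : ∀ R : PosetOfRegions A (A.regionOf b hb), ∃ x, ∃ hx : x ∈ A.complement,
      R = ⟨A.regionOf x hx⟩ := by
    rintro ⟨R⟩
    obtain ⟨x, hx, rfl⟩ := R.exists_eq_regionOf
    exact ⟨x, hx, rfl⟩
  choose pt hpt hpt_eq using hpt
  have hle : ∀ R R' : PosetOfRegions A (A.regionOf b hb),
      R ≤ R' ↔ ∀ i, f i (pt R) ≤ f i (pt R') := by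
    intro R R'
    rw [← hf _ _ (hpt R) (hpt R'),
      ← A.separatingSet_regionOf_subset_iff (hpt R) (hpt R') hb]
    conv_lhs => rw [hpt_eq R, hpt_eq R']
    exact Iff.rfl
  let F : Fin d → PosetOfRegions A (A.regionOf b hb) →
      Colex (Finset ℝ) ×ₗ LinearExtension (PosetOfRegions A (A.regionOf b hb)) :=
    fun i R => toLex (f i (pt R), toLinearExtension R)
  have hF : ∀ i, Function.Injective (F i) := by
    intro i R R' hRR'
    have := congrArg (fun z => (ofLex z).2) hRR'
    exact this
  refine ⟨fun i => LinearOrder.lift' (F i) (hF i), fun R R' => ?_⟩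
  change R ≤ R' ↔ ∀ i, F i R ≤ F i R'
  constructor
  · intro hRR' i
    rw [Prod.Lex.le_iff]
    rcases ((hle R R').1 hRR' i).lt_or_eq with h | h
    · exact Or.inl h
    · exact Or.inr ⟨h, toLinearExtension.monotone hRR'⟩
  · intro hRR'
    rw [hle]
    intro i
    rcases Prod.Lex.le_iff.1 (hRR' i) with h | h
    · exact h.le
    · exact h.1.le

/-! ### The facets of a region -/

/-- The hyperplanes that bound the region of `b` span the arrangement, so there are at least as many
of them as the rank. They arise as a minimal set of inequalities that cut out the open region; for
each of them some point `p` satisfies it with equality and all other inequalities strictly. -/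
theorem exists_facets (A : Arrangement n) {b : EuclideanSpace ℝ (Fin n)}
    (hb : b ∈ A.complement) :
    ∃ M ⊆ A.carrier, A.rank ≤ M.ncard ∧ ∀ H ∈ M, ∃ p ∈ H, ∀ H' ∈ A.carrier, H' ≠ H →
      SeparatesPoints H' (-p) b := by
  classical
  have hnormal : ∀ H, ∃ a : EuclideanSpace ℝ (Fin n),
      H ∈ A.carrier → a ∈ Hᗮ ∧ inner ℝ a b < 0 := by
    intro H
    by_cases hH : H ∈ A.carrier
    · obtain ⟨w, hw⟩ := A.exists_normal_inner_neg hH (hb H hH)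
      exact ⟨w, fun _ => hw⟩
    · exact ⟨0, fun h => absurd h hH⟩
  choose a ha using hnormal
  let Q : Set (Set (Submodule ℝ (EuclideanSpace ℝ (Fin n)))) :=
    {M | M ⊆ A.carrier ∧ ∀ x, (∀ H ∈ M, inner ℝ (a H) x < 0) → ∀ H ∈ A.carrier,
      inner ℝ (a H) x < 0}
  have hQfin : Q.Finite := A.finite.finite_subsets.subset fun M hM => hM.1
  obtain ⟨M, hM⟩ := hQfin.exists_minimal ⟨A.carrier, Set.Subset.rfl, fun x hx => hx⟩
  obtain ⟨hMA, hMneg⟩ := hM.prop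
  have hMfin : M.Finite := A.finite.subset hMA
  refine ⟨M, hMA, ?_, ?_⟩
  · let W := Submodule.span ℝ ((hMfin.toFinset.image a : Finset _) : Set (EuclideanSpace ℝ (Fin n)))
    have hspan : A.normalSpan ≤ W := by
      refine Submodule.span_le.2 ?_
      rintro v ⟨H, hH, hv⟩
      -- Otherwise a line through `b` on which the inequalities in `M` are constant reaches `H`.
      have haW : a H ∈ W := by
        rw [← Submodule.orthogonal_orthogonal W]
        by_contra hnot
        rw [Submodule.mem_orthogonal'] at hnot
        push Not at hnot
        obtain ⟨u, hu, hau⟩ := hnot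
        have hneg := hMneg (b - ((inner ℝ (a H) b : ℝ) / inner ℝ (a H) u) • u) (fun H' hH' => by
          have h0 : (inner ℝ (a H') u : ℝ) = 0 :=
            Submodule.inner_right_of_mem_orthogonal (K := W)
              (Submodule.subset_span (by simpa using ⟨H', hH', rfl⟩)) hu
          rw [inner_sub_right, real_inner_smul_right, h0, mul_zero, sub_zero]
          exact (ha H' (hMA hH')).2) H hH
        rw [inner_sub_right, real_inner_smul_right, div_mul_cancel₀ _ hau, sub_self] at hneg
        exact lt_irrefl _ hneg
      have hv' : v = ((inner ℝ v b : ℝ) / inner ℝ (a H) b) • a H := by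
        refine A.eq_of_mem_orthogonal_of_inner_eq hH hv
          (Submodule.smul_mem _ _ (ha H hH).1) (hb H hH) ?_
        rw [real_inner_smul_left, div_mul_cancel₀ _ (ha H hH).2.ne]
      rw [hv']
      exact Submodule.smul_mem _ _ haW
    calc A.rank ≤ Module.finrank ℝ W := Submodule.finrank_mono hspan
      _ ≤ (hMfin.toFinset.image a).card := finrank_span_finset_le_card _
      _ ≤ hMfin.toFinset.card := Finset.card_image_le
      _ = M.ncard := (Set.ncard_eq_toFinset_card M hMfin).symm
  · intro H hH
    have hHA := hMA hH
    have hx : ∃ x, (∀ H' ∈ M, H' ≠ H → inner ℝ (a H') x < 0) ∧ 0 ≤ (inner ℝ (a H) x : ℝ) := by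
      by_contra hcon
      push Not at hcon
      have hmem : M \ {H} ∈ Q := by
        refine ⟨Set.sdiff_subset.trans hMA, fun x hx => hMneg x fun H' hH' => ?_⟩
        by_cases heq : H' = H
        · rw [heq]
          exact hcon x fun H'' hH'' hne => hx H'' ⟨hH'', hne⟩
        · exact hx H' ⟨hH', heq⟩
      exact (hM.le_of_le hmem Set.sdiff_subset hH).2 rfl
    obtain ⟨x, hx, hxH⟩ := hx
    have haH := ha H hHA
    -- The point of `H` on the segment from `b` to `x`, up to a positive factor.
    let p := (-inner ℝ (a H) b : ℝ) • x + (inner ℝ (a H) x : ℝ) • b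
    have hp : ∀ w, (inner ℝ w p : ℝ) =
        (-inner ℝ (a H) b) * inner ℝ w x + inner ℝ (a H) x * inner ℝ w b := by
      intro w
      rw [inner_add_right, real_inner_smul_right, real_inner_smul_right]
    have hpH : (inner ℝ (a H) p : ℝ) = 0 := by rw [hp]; ring
    have hpM : ∀ H' ∈ M, H' ≠ H → inner ℝ (a H') p < 0 := by
      intro H' hH' hne
      rw [hp]
      nlinarith [mul_neg_of_pos_of_neg (neg_pos.2 haH.2) (hx H' hH' hne),
        mul_nonpos_of_nonneg_of_nonpos hxH (ha H' (hMA hH')).2.le]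
    refine ⟨p, (A.inner_eq_zero_iff_mem hHA haH.1 (ne_zero_of_inner_neg haH.2) p).1 hpH,
      fun H' hH' hne => ?_⟩
    have haH' := ha H' hH'
    rw [A.separatesPoints_iff hH' haH'.1 haH'.2, inner_neg_right, neg_pos]
    by_contra hnonneg
    rw [not_lt] at hnonneg
    obtain ⟨z, hz, hz'⟩ : ∃ z ∈ H, z ∉ H' := by
      by_contra hcon
      push Not at hcon
      exact hne (A.eq_of_mem_orthogonal hH' hHA haH'.1
        (Submodule.orthogonal_le hcon haH'.1) (ne_zero_of_inner_neg haH'.2))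
    have hz0 : (inner ℝ (a H') z : ℝ) ≠ 0 := fun h =>
      hz' ((A.inner_eq_zero_iff_mem hH' haH'.1 (ne_zero_of_inner_neg haH'.2) z).1 h)
    -- Moving from `p` in this direction leaves the half-space of `H'` but none of those in `M`.
    let u := b + ((1 - inner ℝ (a H') b : ℝ) / inner ℝ (a H') z) • z
    have huH' : (inner ℝ (a H') u : ℝ) = 1 := by
      rw [inner_add_right, real_inner_smul_right, div_mul_cancel₀ _ hz0]; ring
    have huH : (inner ℝ (a H) u : ℝ) = inner ℝ (a H) b := by
      rw [inner_add_right, real_inner_smul_right,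
        Submodule.inner_left_of_mem_orthogonal hz haH.1, mul_zero, add_zero]
    have hev : ∀ᶠ ε : ℝ in 𝓝[>] 0, ∀ K ∈ M, inner ℝ (a K) (p + ε • u) < 0 := by
      rw [Filter.eventually_all_finite hMfin]
      intro K hK
      by_cases hKH : K = H
      · filter_upwards [self_mem_nhdsWithin] with ε hε
        rw [hKH, inner_add_right, real_inner_smul_right, hpH, huH, zero_add]
        exact mul_neg_of_pos_of_neg hε haH.2
      · have hcont : Continuous fun ε : ℝ => (inner ℝ (a K) (p + ε • u) : ℝ) := by fun_prop
        refine nhdsWithin_le_nhds (hcont.continuousAt.eventually_lt continuousAt_const ?_)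
        simpa using hpM K hK hKH
    obtain ⟨ε, hε, hεpos⟩ := (hev.and self_mem_nhdsWithin).exists
    have hneg := hMneg _ hε H' hH'
    rw [inner_add_right, real_inner_smul_right, huH', mul_one] at hneg
    have : (0 : ℝ) < ε := hεpos
    linarith

/-- Beyond a facet `H` of the region of `b` lies a region that only `H` separates from `b`. -/
theorem exists_separatesPoints_iff_eq (A : Arrangement n) {b p : EuclideanSpace ℝ (Fin n)}
    (hb : b ∈ A.complement) {H : Submodule ℝ (EuclideanSpace ℝ (Fin n))} (hp : p ∈ H)
    (hpneg : ∀ H' ∈ A.carrier, H' ≠ H → SeparatesPoints H' (-p) b) :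
    ∃ x ∈ A.complement, ∀ H' ∈ A.carrier, SeparatesPoints H' x b ↔ H' = H := by
  have hev : ∀ᶠ ε : ℝ in 𝓝[>] 0, ∀ K ∈ A.carrier,
      (p - ε • b ∉ K ∧ (SeparatesPoints K (p - ε • b) b ↔ K = H)) := by
    rw [Filter.eventually_all_finite A.finite]
    intro K hK
    obtain ⟨w, hw, hwb⟩ := A.exists_normal_inner_neg hK (hb K hK)
    have hiff := fun z => A.inner_eq_zero_iff_mem hK hw (ne_zero_of_inner_neg hwb) z
    by_cases hKH : K = H
    · filter_upwards [self_mem_nhdsWithin] with ε hε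
      have hpos : (0 : ℝ) < inner ℝ w (p - ε • b) := by
        rw [inner_sub_right, real_inner_smul_right, (hiff p).2 (hKH ▸ hp), zero_sub]
        exact neg_pos.2 (mul_neg_of_pos_of_neg hε hwb)
      rw [A.separatesPoints_iff hK hw hwb, ← hiff]
      exact ⟨hpos.ne', iff_of_true hpos hKH⟩
    · have hneg := (A.separatesPoints_iff hK hw hwb).1 (hpneg K hK hKH)
      rw [inner_neg_right, neg_pos] at hneg
      have hcont : Continuous fun ε : ℝ => (inner ℝ w (p - ε • b) : ℝ) := by fun_prop
      have : ∀ᶠ ε : ℝ in 𝓝[>] 0, inner ℝ w (p - ε • b) < (0 : ℝ) :=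
        nhdsWithin_le_nhds (hcont.continuousAt.eventually_lt continuousAt_const (by simpa))
      filter_upwards [this] with ε hε
      rw [A.separatesPoints_iff hK hw hwb, ← hiff]
      exact ⟨hε.ne, iff_of_false (not_lt.2 hε.le) hKH⟩
  obtain ⟨ε, hε⟩ := hev.exists
  exact ⟨p - ε • b, fun K hK => (hε K hK).1, fun K hK => (hε K hK).2⟩

/-- The regions beyond the facets of the base region and their antipodes form a standard example:
no linear extension reverses two of these pairs. -/
theorem rank_le_of_isIntersectionOfLinearExtensions (A : Arrangement n)
    {b : EuclideanSpace ℝ (Fin n)} (hb : b ∈ A.complement) {d : ℕ}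
    (h : IsIntersectionOfLinearExtensions (PosetOfRegions A (A.regionOf b hb)) d) :
    A.rank ≤ d := by
  obtain ⟨L, hL⟩ := h
  obtain ⟨M, hMA, hrank, hM⟩ := A.exists_facets hb
  have hMfin : M.Finite := A.finite.subset hMA
  have hx : ∀ H : M, ∃ x ∈ A.complement, ∀ H' ∈ A.carrier, SeparatesPoints H' x b ↔ H' = H := by
    rintro ⟨H, hH⟩
    obtain ⟨p, hp, hpneg⟩ := hM H hH
    exact A.exists_separatesPoints_iff_eq hb hp hpneg
  choose x hx hxsep using hx
  have hnx : ∀ H, -x H ∈ A.complement := fun H K hK hmem => hx H K hK (by simpa using neg_mem hmem)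
  let P := PosetOfRegions A (A.regionOf b hb)
  let atom : M → P := fun H => ⟨A.regionOf (x H) (hx H)⟩
  let coatom : M → P := fun H => ⟨A.regionOf (-x H) (hnx H)⟩
  have hle : ∀ H H', atom H ≤ coatom H' ↔ H ≠ H' := by
    intro H H'
    refine (A.separatingSet_regionOf_subset_iff (hx H) (hnx H') hb).trans ?_
    constructor
    · rintro h rfl
      have := h H (hMA H.2) ((hxsep H H (hMA H.2)).2 rfl)
      rw [A.separatesPoints_neg_iff (hMA H.2) (hx H H (hMA H.2)) (hb H (hMA H.2))] at this
      exact this ((hxsep H H (hMA H.2)).2 rfl)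
    · intro hne K hK hsep
      rw [A.separatesPoints_neg_iff hK (hx H' K hK) (hb K hK), hxsep H' K hK]
      rw [hxsep H K hK] at hsep
      exact fun h => hne (Subtype.ext (hsep.symm.trans h))
  have hrev : ∀ H, ∃ i, ¬ (L i).le (atom H) (coatom H) := by
    intro H
    by_contra hcon
    push Not at hcon
    exact (hle H H).1 ((hL _ _).2 hcon) rfl
  choose i hi using hrev
  have hinj : Function.Injective i := by
    intro H H' heq
    by_contra hne
    have h1 := (hL _ _).1 ((hle H H').2 hne) (i H)
    have h2 := (hL _ _).1 ((hle H' H).2 (Ne.symm hne)) (i H)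
    have h3 := ((L (i H)).le_total _ _).resolve_left (hi H)
    have h4 := ((L (i H)).le_total _ _).resolve_left (heq ▸ hi H')
    exact hi H ((L (i H)).le_trans _ _ _ h1 ((L (i H)).le_trans _ _ _ h4 h2))
  calc A.rank ≤ M.ncard := hrank
    _ = Nat.card M := rfl
    _ ≤ Nat.card (Fin d) := Nat.card_le_card_of_injective i hinj
    _ = d := Nat.card_fin d

/-! ### Arrangements of rank at most two -/

theorem mem_normalSpan (A : Arrangement n) {H : Submodule ℝ (EuclideanSpace ℝ (Fin n))}
    (hH : H ∈ A.carrier) {w : EuclideanSpace ℝ (Fin n)} (hw : w ∈ Hᗮ) : w ∈ A.normalSpan :=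
  Submodule.subset_span ⟨H, hH, hw⟩

theorem rank_pos (A : Arrangement n) : 0 < A.rank := by
  obtain ⟨H, hH⟩ := A.nonempty
  obtain ⟨w, hw, hw0⟩ := A.exists_normal hH
  refine Module.finrank_pos_iff_exists_ne_zero.2 ⟨⟨w, A.mem_normalSpan hH hw⟩, fun h => hw0 ?_⟩
  exact congrArg Subtype.val h

/-- Normal vectors of two distinct hyperplanes span a plane in the span of the arrangement. -/
theorem finrank_span_normals (A : Arrangement n)
    {H' H'' : Submodule ℝ (EuclideanSpace ℝ (Fin n))} (hH' : H' ∈ A.carrier)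
    (hH'' : H'' ∈ A.carrier) (hne : H' ≠ H'') {a c : EuclideanSpace ℝ (Fin n)} (ha : a ∈ H'ᗮ)
    (hc : c ∈ H''ᗮ) (ha0 : a ≠ 0) (hc0 : c ≠ 0) :
    Submodule.span ℝ (Set.range ![a, c]) ≤ A.normalSpan ∧
      Module.finrank ℝ (Submodule.span ℝ (Set.range ![a, c])) = 2 := by
  constructor
  · rw [Submodule.span_le]
    rintro _ ⟨i, rfl⟩
    fin_cases i
    · exact A.mem_normalSpan hH' ha
    · exact A.mem_normalSpan hH'' hc
  · have hli : LinearIndependent ℝ ![a, c] := by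
      rw [LinearIndependent.pair_iff' ha0]
      intro r hr
      exact hne (A.eq_of_mem_orthogonal hH' hH'' (hr ▸ Submodule.smul_mem _ r ha) hc hc0)
    rw [finrank_span_eq_card hli, Fintype.card_fin]

theorem two_le_rank (A : Arrangement n)
    {H' H'' : Submodule ℝ (EuclideanSpace ℝ (Fin n))} (hH' : H' ∈ A.carrier)
    (hH'' : H'' ∈ A.carrier) (hne : H' ≠ H'') : 2 ≤ A.rank := by
  obtain ⟨a, ha, ha0⟩ := A.exists_normal hH'
  obtain ⟨c, hc, hc0⟩ := A.exists_normal hH''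
  obtain ⟨h1, h2⟩ := A.finrank_span_normals hH' hH'' hne ha hc ha0 hc0
  exact h2.symm.le.trans (Submodule.finrank_mono h1)

theorem inf_le_of_rank_le_two (A : Arrangement n) (hA : A.rank ≤ 2)
    {H H' H'' : Submodule ℝ (EuclideanSpace ℝ (Fin n))} (hH : H ∈ A.carrier)
    (hH' : H' ∈ A.carrier) (hH'' : H'' ∈ A.carrier) (hne : H' ≠ H'') : H' ⊓ H'' ≤ H := by
  obtain ⟨a, ha, ha0⟩ := A.exists_normal hH'
  obtain ⟨c, hc, hc0⟩ := A.exists_normal hH''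
  obtain ⟨w, hw, hw0⟩ := A.exists_normal hH
  obtain ⟨h1, h2⟩ := A.finrank_span_normals hH' hH'' hne ha hc ha0 hc0
  have heq := Submodule.eq_of_le_of_finrank_le h1 (hA.trans h2.symm.le)
  have hw' := A.mem_normalSpan hH hw
  rw [← heq, Matrix.range_cons, Matrix.range_cons, Matrix.range_empty, Set.union_empty,
    Set.singleton_union, Submodule.mem_span_pair] at hw'
  obtain ⟨r, s, rfl⟩ := hw'
  intro z hz
  rw [← A.inner_eq_zero_iff_mem hH hw hw0, inner_add_left, real_inner_smul_left,
    real_inner_smul_left, Submodule.inner_left_of_mem_orthogonal hz.1 ha,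
    Submodule.inner_left_of_mem_orthogonal hz.2 hc]
  ring

/-- In rank at most two every region has suitable rankings: one for a facet, and one for the other
hyperplanes, which are met in turn on the way along that facet. -/
theorem hasRankings_of_rank_le_two (A : Arrangement n) (hA : A.rank ≤ 2)
    {b : EuclideanSpace ℝ (Fin n)} (hb : b ∈ A.complement) :
    HasRankings A.carrier b A.rank := by
  obtain ⟨M, hMA, hrank, hM⟩ := A.exists_facets hb
  have hMne : M.Nonempty := by
    rw [Set.nonempty_iff_ne_empty]
    rintro rfl
    rw [Set.ncard_empty] at hrank
    exact absurd A.rank_pos (not_lt.2 hrank)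
  obtain ⟨H, hH⟩ := hMne
  obtain ⟨p, hp, hpneg⟩ := hM H hH
  have hHA := hMA hH
  have h1 : HasRankings {H} b 1 := by
    have := (hasRankings_empty b).union A (Set.empty_subset _) (Set.singleton_subset_iff.2 hHA)
      (v := -b) (fun _ h => h.elim) (fun _ h => h.elim)
      (fun K hK => by
        rw [Set.mem_singleton_iff.1 hK, A.separatesPoints_neg_iff hHA (hb H hHA) (hb H hHA)]
        exact A.not_separatesPoints_self hHA (hb H hHA))
      (fun H' hH' H'' hH'' hne => absurd (hH'.trans hH''.symm) hne)
    rwa [Set.empty_union] at this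
  rcases (Nat.succ_le_of_lt A.rank_pos).eq_or_lt with hr | hr
  · have hcar : A.carrier = {H} := by
      refine Set.Subset.antisymm (fun K hK => ?_) (Set.singleton_subset_iff.2 hHA)
      by_contra hne
      have := A.two_le_rank hK hHA hne
      omega
    rw [← hr, hcar]
    exact h1
  · have h2 := h1.union A (T := A.carrier \ {H}) (v := -p) (Set.singleton_subset_iff.2 hHA)
      Set.sdiff_subset (fun K hK => hb K (hK ▸ hHA)) (fun K hK => hK ▸ neg_mem hp)
      (fun K hK => hpneg K hK.1 hK.2)
      (fun H' hH' H'' hH'' hne =>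
        ⟨H, rfl, A.inf_le_of_rank_le_two hA hHA hH'.1 hH''.1 hne⟩)
    rw [Set.union_sdiff_cancel (Set.singleton_subset_iff.2 hHA)] at h2
    have : A.rank = 2 := by omega
    rwa [this]

/-! ### Canonical base regions -/

/-- In a decomposition `A = A₀ ⊎ A₁` there is a vector that lies in all hyperplanes of `A₀` and in
none of `A₁`. -/
theorem IsSupersolvableDecomposition.exists_direction {A A₀ : Arrangement n}
    (h : IsSupersolvableDecomposition A A₀) :
    ∃ v, (∀ H ∈ A₀.carrier, v ∈ H) ∧ ∀ H ∈ A.carrier \ A₀.carrier, v ∉ H := by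
  have hnot : ¬ A.normalSpan ≤ A₀.normalSpan := fun hle => by
    have h1 := Submodule.finrank_mono hle
    have h2 := h.rank_eq
    unfold rank at h2
    omega
  have hnot' : ¬ A₀.normalSpanᗮ ≤ A.normalSpanᗮ := by
    rwa [Submodule.orthogonal_le_orthogonal_iff]
  obtain ⟨v, hv, hv'⟩ := SetLike.not_le_iff_exists.1 hnot'
  have hvA₀ : ∀ H ∈ A₀.carrier, v ∈ H := by
    intro H hH
    obtain ⟨w, hw, hw0⟩ := A₀.exists_normal hH
    rw [← A₀.inner_eq_zero_iff_mem hH hw hw0]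
    exact Submodule.inner_right_of_mem_orthogonal (A₀.mem_normalSpan hH hw) hv
  obtain ⟨K, hK, hvK⟩ : ∃ K ∈ A.carrier, v ∉ K := by
    by_contra hcon
    push Not at hcon
    refine hv' ?_
    have hle : A.normalSpan ≤ (Submodule.span ℝ {v})ᗮ := by
      refine Submodule.span_le.2 ?_
      rintro w ⟨H, hH, hw⟩
      exact Submodule.mem_orthogonal_singleton_iff_inner_left.2
        (Submodule.inner_left_of_mem_orthogonal (hcon H hH) hw)
    exact Submodule.orthogonal_le hle
      (Submodule.le_orthogonal_orthogonal _ (Submodule.mem_span_singleton_self v))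
  refine ⟨v, hvA₀, ?_⟩
  rintro H' ⟨hH', hH'₀⟩ hvH'
  have hKA₀ : K ∉ A₀.carrier := fun hK₀ => hvK (hvA₀ K hK₀)
  have hne : H' ≠ K := by rintro rfl; exact hvK hvH'
  obtain ⟨H, ⟨hH, hle⟩, -⟩ := h.existsUnique H' ⟨hH', hH'₀⟩ K ⟨hK, hKA₀⟩ hne
  obtain ⟨w, hw, hw0⟩ := A₀.exists_normal hH
  obtain ⟨p, hp, q, hq, rfl⟩ := exists_add_eq_of_inf_le hle hw
  -- Both summands vanish at `v`, hence `q = 0`, and `H` and `H'` have a normal vector in common.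
  have hwv := Submodule.inner_left_of_mem_orthogonal (hvA₀ H hH) hw
  rw [inner_add_left, Submodule.inner_left_of_mem_orthogonal hvH' hp, zero_add] at hwv
  have hq0 : q = 0 :=
    A.eq_of_mem_orthogonal_of_inner_eq hK hq (zero_mem _) hvK (by rw [hwv, inner_zero_left])
  subst hq0
  rw [add_zero] at hw hw0
  exact hH'₀ (A.eq_of_mem_orthogonal hH' (h.subset hH) hp hw hw0 ▸ hH)

/-- A point far out from `b` in the direction `v`: no hyperplane that contains `v` separates it from
`b`, and any other hyperplane separates it from `b` if and only if it separates `v` from `b`. -/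
theorem exists_far_point {A A₀ : Arrangement n} (hsub : A₀.carrier ⊆ A.carrier)
    {b v : EuclideanSpace ℝ (Fin n)} (hb : b ∈ A.complement) (hv : ∀ H ∈ A₀.carrier, v ∈ H)
    (hv' : ∀ H ∈ A.carrier \ A₀.carrier, v ∉ H) :
    ∃ x ∈ A.complement, (∀ H ∈ A₀.carrier, ¬ SeparatesPoints H x b) ∧
      ∀ H ∈ A.carrier \ A₀.carrier, SeparatesPoints H x b ↔ SeparatesPoints H v b := by
  have hev : ∀ᶠ t : ℝ in atTop, ∀ K ∈ A.carrier, b + t • v ∉ K ∧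
      (K ∉ A₀.carrier → (SeparatesPoints K (b + t • v) b ↔ SeparatesPoints K v b)) ∧
      (K ∈ A₀.carrier → ¬ SeparatesPoints K (b + t • v) b) := by
    rw [Filter.eventually_all_finite A.finite]
    intro K hK
    obtain ⟨w, hw, hwb⟩ := A.exists_normal_inner_neg hK (hb K hK)
    have hiff := fun z => A.inner_eq_zero_iff_mem hK hw (ne_zero_of_inner_neg hwb) z
    have hin : ∀ t : ℝ, (inner ℝ w (b + t • v) : ℝ) = inner ℝ w b + t * inner ℝ w v := by
      intro t
      rw [inner_add_right, real_inner_smul_right]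
    simp only [A.separatesPoints_iff hK hw hwb, ← hiff, hin]
    by_cases hK₀ : K ∈ A₀.carrier
    · rw [(hiff v).2 (hv K hK₀)]
      refine Eventually.of_forall fun t => ⟨?_, fun h => absurd hK₀ h, fun _ => ?_⟩ <;> linarith
    · have hwv : (inner ℝ w v : ℝ) ≠ 0 := fun h => hv' K ⟨hK, hK₀⟩ ((hiff v).1 h)
      rcases lt_or_gt_of_ne hwv with hneg | hpos
      · filter_upwards [eventually_ge_atTop (0 : ℝ)] with t ht
        have := mul_nonpos_of_nonneg_of_nonpos ht hneg.le
        exact ⟨by linarith, fun _ => iff_of_false (by linarith) (by linarith),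
          fun h => absurd h hK₀⟩
      · filter_upwards [(tendsto_id.atTop_mul_const hpos).eventually_gt_atTop (-inner ℝ w b)]
          with t ht
        have ht' : -inner ℝ w b < t * inner ℝ w v := ht
        exact ⟨by linarith, fun _ => iff_of_true (by linarith) hpos, fun h => absurd h hK₀⟩
  obtain ⟨t, ht⟩ := hev.exists
  exact ⟨b + t • v, fun K hK => (ht K hK).1, fun K hK => (ht K (hsub hK)).2.2 hK,
    fun K hK => (ht K hK.1).2.1 hK.2⟩

/-- If the regions of `A` inside the region of `A₀` around `b` form a chain, then a direction common
to all hyperplanes of `A₀` can be oriented so that the line through `b` crosses the remaining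
hyperplanes only after `b`: otherwise the two far ends of that line lie in incomparable regions. -/
theorem IsSupersolvableDecomposition.exists_crossing_direction {A A₀ : Arrangement n}
    (h : IsSupersolvableDecomposition A A₀) {b : EuclideanSpace ℝ (Fin n)}
    (hb : b ∈ A.complement) (hb₀ : b ∈ A₀.complement)
    (hlin : IsChain (· ≤ ·) {R : PosetOfRegions A (A.regionOf b hb) |
      R.region.set ⊆ (A₀.regionOf b hb₀).set}) :
    ∃ v, (∀ H ∈ A₀.carrier, v ∈ H) ∧
      ∀ H ∈ A.carrier \ A₀.carrier, SeparatesPoints H v b := by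
  obtain ⟨v, hv, hv'⟩ := h.exists_direction
  by_cases hall : ∀ H ∈ A.carrier \ A₀.carrier, SeparatesPoints H v b
  · exact ⟨v, hv, hall⟩
  push Not at hall
  obtain ⟨H₁, hH₁, hsep₁⟩ := hall
  have hflip : ∀ H ∈ A.carrier \ A₀.carrier,
      (SeparatesPoints H (-v) b ↔ ¬ SeparatesPoints H v b) := fun H hH =>
    A.separatesPoints_neg_iff hH.1 (hv' H hH) (hb H hH.1)
  refine ⟨-v, fun H hH => neg_mem (hv H hH), ?_⟩
  by_contra hcon
  push Not at hcon
  obtain ⟨H₂, hH₂, hsep₂⟩ := hcon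
  have hinside : ∀ x, ∀ hx : x ∈ A.complement, (∀ H ∈ A₀.carrier, ¬ SeparatesPoints H x b) →
      (A.regionOf x hx).set ⊆ (A₀.regionOf b hb₀).set := by
    intro x hx hns
    have hcompl : A.complement ⊆ A₀.complement := fun z hz H hH => hz H (h.subset hH)
    rw [← A₀.regionOf_eq_of_not_separatesPoints (hcompl hx) hb₀ hns]
    exact closure_mono (connectedComponentIn_mono x hcompl)
  obtain ⟨x, hx, hx₀, hx₁⟩ := exists_far_point h.subset hb hv hv'
  obtain ⟨y, hy, hy₀, hy₁⟩ := exists_far_point h.subset hb (v := -v)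
    (fun H hH => neg_mem (hv H hH)) (fun H hH hmem => hv' H hH (by simpa using neg_mem hmem))
  have htot := hlin.total (x := ⟨A.regionOf x hx⟩) (y := ⟨A.regionOf y hy⟩)
    (hinside x hx hx₀) (hinside y hy hy₀)
  rcases htot with hle | hle
  · have := (A.separatingSet_regionOf_subset_iff hx hy hb).1 hle H₂ hH₂.1
    rw [hx₁ H₂ hH₂, hy₁ H₂ hH₂] at this
    exact hsep₂ (this (by
      by_contra hns
      exact hsep₂ ((hflip H₂ hH₂).2 hns)))
  · have := (A.separatingSet_regionOf_subset_iff hy hx hb).1 hle H₁ hH₁.1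
    rw [hx₁ H₁ hH₁, hy₁ H₁ hH₁] at this
    exact hsep₁ (this ((hflip H₁ hH₁).2 hsep₁))

theorem IsCanonicalBase.hasRankings {A : Arrangement n} {B : Region A}
    (h : IsCanonicalBase A B) : ∀ b, ∀ hb : b ∈ A.complement, B = A.regionOf b hb →
      HasRankings A.carrier b A.rank := by
  induction h with
  | of_rank_le_two A B hA => exact fun b hb _ => A.hasRankings_of_rank_le_two hA hb
  | step A A₀ B B₀ hA hB hB₀ hlin ih =>
    rintro b hb rfl
    have hb₀ : b ∈ A₀.complement := fun H hH => hb H (hA.subset hH)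
    obtain ⟨b', hb', rfl⟩ := B₀.exists_eq_regionOf
    have heq := A₀.regionOf_eq_of_mem hb₀ hb' (hB (A.mem_regionOf hb))
    rw [← heq] at hlin
    obtain ⟨v, hv, hsep⟩ := hA.exists_crossing_direction hb hb₀ hlin
    have := (ih b hb₀ heq.symm).union A hA.subset Set.sdiff_subset hb₀ hv hsep
      (fun H' hH' H'' hH'' hne => (hA.existsUnique H' hH' H'' hH'' hne).exists)
    rwa [Set.union_sdiff_cancel hA.subset, hA.rank_eq] at this

end Arrangement

theorem mainTheorem5 (n : ℕ) (A : Arrangement n) (hA : A.IsSupersolvable)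
    (B : A.Region) (hB : Arrangement.IsCanonicalBase A B) :
    IsOrderDimension (Arrangement.PosetOfRegions A B) A.rank := by
  obtain ⟨b, hb, rfl⟩ := B.exists_eq_regionOf
  exact ⟨(hB.hasRankings b hb rfl).isIntersectionOfLinearExtensions A hb,
    fun _ hk => A.rank_le_of_isIntersectionOfLinearExtensions hb hk⟩
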